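/- Let $V$ be a finite set of messages; for each $i\in V$ there is one receiver, also called $i$, that demands message $i$. Let $\mathcal D$ be a loopless digraph on $V$ (the side-information digraph), where an edge $(i,j)$ means that receiver $i$ knows message $j$. Two senders possess the messages in $\mathcal M_1$ and $\mathcal M_2$ respectively, where $\mathcal M_1\cup\mathcal M_2=V$. Put $\mathcal P_1=\mathcal M_1\setminus\mathcal M_2$, $\mathcal P_2=\mathcal M_2\setminus\mathcal M_1$, $\mathcal P_3=\mathcal M_1\cap\mathcal M_2$, $\mathcal P=(\mathcal P_1,\mathcal P_2,\mathcal P_3)$, and let $\mathcal D_s$ be the sub-digraph of $\mathcal D$ induced by $\mathcal P_s$, $s\in\{1,2,3\}$. A two-sender index code for $t$-bit messages consists of encoders $\mathbb E_s:(\mathbb F_2^t)^{\mathcal M_s}\to\mathbb F_2^{p_s}$, $s\in\{1,2\}$, such that every receiver $i$ can recover message $i$ from the two sub-codewords and its side-information; encoders and decoders are arbitrary functions. Let $\beta_t(\mathcal D,\mathcal P)$ be the minimum of $(p_1+p_2)/t$ over all such codes and let $\beta(\mathcal D,\mathcal P)=\inf_{t\ge1}\beta_t(\mathcal D,\mathcal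 P)$. For a digraph $\mathcal G$ let $\beta_t(\mathcal G)$ be the minimum of $p/t$ over all single-sender index codes (one encoder into $\mathbb F_2^{p}$ that sees all the messages) for the side-information digraph $\mathcal G$ and $t$-bit messages, and let $\beta(\mathcal G)=\inf_{t\ge1}\beta_t(\mathcal G)$. The interaction digraph $\mathcal H$ has vertex set $\{1,2,3\}$ and an edge $(i,j)$, $i\ne j$, whenever $\mathcal D$ has an edge from some vertex of $\mathcal D_i$ to some vertex of $\mathcal D_j$. The interactions are fully-participated if, for every edge $(i,j)$ of $\mathcal H$, $\mathcal D$ contains all edges from vertices of $\mathcal D_i$ to vertices of $\mathcal D_j$. Case II-D consists of the twelve interaction digraphs $\mathcal H_{46},\dots,\mathcal H_{57}$, that is, those that contain both edges $(2,3)$ and $(3,2)$ and do not contain both $(1,3)$ and $(3,1)$ (the edges between $1$ and $2$ being arbitrary). Theorem (Case II-D). If $\mathcal H$ belongs to Case II-D and the interactions are fully-participated, then $$\beta(\mathcal D,\mathcal P)=\max\{\beta(\mathcal D_2),\beta(\mathcal D_3)\}+\beta(\mathcal D_1).$$ -/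

import Mathlib

namespace IndexCoding

/-- The set `𝔽₂^n` of binary words of length `n`. -/
abbrev Word (n : ℕ) : Type := Fin n → ZMod 2

/-! ### Single-sender unicast index coding

In a side-information digraph `D`, a vertex is at once a message and the receiver demanding it;
`D.Adj i j` says that receiver `i` has message `j` as side-information. -/

section SingleSender

universe u

variable {V : Type u}

/-- A (not necessarily linear) single-sender index code of length `p` for `t`-bit messages. -/
structure Code (D : Digraph V) (t p : ℕ) where
  /-- the encoder, which sees all the messages -/
  enc : (V → Word t) → Word p
  /-- the decoder of receiver `i`, which sees the codeword and the side-information -/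
  dec : (i : V) → Word p → ({j : V // D.Adj i j} → Word t) → Word t
  /-- every receiver recovers its demanded message -/
  correct : ∀ (x : V → Word t) (i : V), dec i (enc x) (fun j => x j) = x i

/-- The optimal codelength with `t`-bit messages. -/
noncomputable def optLength (D : Digraph V) (t : ℕ) : ℕ :=
  sInf {p : ℕ | Nonempty (Code D t p)}

/-- The optimal broadcast rate `β_t(D)` with `t`-bit messages. -/
noncomputable def betaT (D : Digraph V) (t : ℕ) : ℝ :=
  (optLength D t : ℝ) / (t : ℝ)

/-- The optimal broadcast rate `β(D) = inf_{t ≥ 1} β_t(D)`. -/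
noncomputable def beta (D : Digraph V) : ℝ :=
  ⨅ t : ℕ+, betaT D t

end SingleSender

/-! ### Two-sender unicast index coding -/

/-- The labels `1, 2, 3` of the three sub-problems. -/
inductive Label : Type
  | one
  | two
  | three

universe u

/-- A two-sender unicast index coding problem with message (and receiver) set `V`. -/
structure TUICP (V : Type u) where
  /-- the side-information digraph -/
  D : Digraph V
  /-- no receiver has its own demand as side-information -/
  irrefl : ∀ i : V, ¬ D.Adj i i
  /-- the messages available at the first sender -/
  M₁ : Set V
  /-- the messages available at the second sender -/
  M₂ : Set V
  /-- every message is available at some sender -/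
  cover : M₁ ∪ M₂ = Set.univ

namespace TUICP

variable {V : Type u} (I : TUICP V)

/-- A (not necessarily linear) two-sender index code for `t`-bit messages, in which sender `s`
transmits a sub-codeword of length `p_s` depending only on the messages it has. -/
structure Code (t p₁ p₂ : ℕ) where
  /-- the encoder of the first sender -/
  enc₁ : (I.M₁ → Word t) → Word p₁
  /-- the encoder of the second sender -/
  enc₂ : (I.M₂ → Word t) → Word p₂
  /-- the decoder of receiver `i`, which sees both sub-codewords and the side-information -/
  dec : (i : V) → Word p₁ → Word p₂ → ({j : V // I.D.Adj i j} → Word t) → Word t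
  /-- every receiver recovers its demanded message -/
  correct : ∀ (x : V → Word t) (i : V),
    dec i (enc₁ (fun j => x j)) (enc₂ (fun j => x j)) (fun j => x j) = x i

/-- The optimal total codelength `p₁ + p₂` with `t`-bit messages. -/
noncomputable def optLength (t : ℕ) : ℕ :=
  sInf {p : ℕ | ∃ p₁ p₂ : ℕ, p = p₁ + p₂ ∧ Nonempty (I.Code t p₁ p₂)}

/-- The optimal broadcast rate `β_t(D, P)` with `t`-bit messages. -/
noncomputable def betaT (t : ℕ) : ℝ :=
  (I.optLength t : ℝ) / (t : ℝ)

/-- The optimal broadcast rate `β(D, P) = inf_{t ≥ 1} β_t(D, P)`. -/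
noncomputable def beta : ℝ :=
  ⨅ t : ℕ+, I.betaT t

/-- `P₁` and `P₂` are the messages available only at the first, respectively the second, sender,
and `P₃` consists of the messages available at both. -/
def P : Label → Set V
  | .one => I.M₁ \ I.M₂
  | .two => I.M₂ \ I.M₁
  | .three => I.M₁ ∩ I.M₂

/-- The sub-digraph `D_s` of the side-information digraph induced by `P_s`. -/
def sub (s : Label) : Digraph (I.P s) where
  Adj u v := I.D.Adj u v

/-- The interaction digraph: there is an edge `(i, j)`, `i ≠ j`, iff some vertex of `D_i` has an
edge to some vertex of `D_j`. -/
def interactionDigraph : Digraph Label where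
  Adj i j := i ≠ j ∧ ∃ u ∈ I.P i, ∃ v ∈ I.P j, I.D.Adj u v

/-- Every existing interaction `D_i → D_j` is fully-participated: there are edges from every vertex
of `D_i` to every vertex of `D_j`. -/
def FullyParticipated : Prop :=
  ∀ i j : Label, I.interactionDigraph.Adj i j → ∀ u ∈ I.P i, ∀ v ∈ I.P j, I.D.Adj u v

end TUICP

/-- The interaction digraphs of Case II-D: the twelve loopless digraphs on `{1, 2, 3}` that contain
both edges between `2` and `3` and at most one of the two edges between `1` and `3` (with any
combination of edges between `1` and `2`). -/
def caseIID : Set (Digraph Label) :=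
  {H | (∀ i, ¬ H.Adj i i) ∧ H.Adj .two .three ∧ H.Adj .three .two ∧
    ¬ (H.Adj .one .three ∧ H.Adj .three .one)}

end IndexCoding

/-! Upper bound: sender 1 encodes `P .one`, and sender 2 transmits the sum of codewords for `P .two`
and `P .three`, padded to equal length. Full participation in both directions between 2 and 3 lets
each of these receivers cancel the other summand (`optLength_le`).

Lower bound, `D_1` and `D_2`: neither sender sees the other's private messages, so once all other
messages are zero each sub-codeword is a single-sender code for its own part
(`optLength_one_add_optLength_two_le`).

Lower bound, `D_1` and `D_3`: sender 1 sees both parts, so the senders are merged. Since an edge of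
`H` between 1 and 3 is missing, the receivers of one part know nothing of the other part. For such
one-sided side-information the rates add: by double counting, some codeword is compatible with a
large set of messages of that uninformed part. No two members of this set are confusable, so naming
a translate that contains the message tuple is an index code, and few translates cover everything
(`IsJoinValid.two_pow_le`). The logarithmic loss in the covering disappears on taking many
independent copies. -/

namespace IndexCoding

open Finset Filter

/-! ### Single-sender codes as separation of confusable tuples. -/

section SingleSender

variable {V : Type*} {X Y C C' : Type*}

/-- An encoder over arbitrary alphabets is valid if no two message tuples which are confusable at
some receiver have the same codeword. -/
def IsValid (D : Digraph V) (enc : (V → X) → C) : Prop :=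
  ∀ x y i, enc x = enc y → (∀ j, D.Adj i j → x j = y j) → x i = y i

/-- A receiver can decode by picking any tuple consistent with what it sees: validity makes all of
them agree at its demand. The default 0 is never used on genuine codewords. -/
theorem nonempty_code_iff {D : Digraph V} {t p : ℕ} :
    Nonempty (Code D t p) ↔ ∃ enc : (V → Word t) → Word p, IsValid D enc := by
  classical
  constructor
  · rintro ⟨c⟩
    refine ⟨c.enc, fun x y i h hs => ?_⟩
    rw [← c.correct x i, ← c.correct y i, h]
    congr 1
    funext j
    exact hs j j.2
  · rintro ⟨enc, h⟩
    refine ⟨⟨enc, fun i w s => if hx : ∃ x, enc x = w ∧ ∀ j : {j : V // D.Adj i j}, x j = s j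
      then hx.choose i else 0, fun x i => ?_⟩⟩
    have hx : ∃ x', enc x' = enc x ∧ ∀ j : {j : V // D.Adj i j}, x' j = x j := ⟨x, rfl, by simp⟩
    rw [dif_pos hx]
    exact h _ _ _ hx.choose_spec.1 fun j hj => hx.choose_spec.2 ⟨j, hj⟩

theorem IsValid.comp_injective {D : Digraph V} {enc : (V → X) → C} (h : IsValid D enc)
    {f : C → C'} (hf : Function.Injective f) : IsValid D (f ∘ enc) :=
  fun _ _ i hxy => h _ _ i (hf hxy)

theorem IsValid.comap_alphabet {D : Digraph V} {enc : (V → X) → C} (h : IsValid D enc)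
    {e : Y → X} (he : Function.Injective e) : IsValid D fun y : V → Y => enc fun v => e (y v) :=
  fun _ _ i hxy hs => he (h _ _ i hxy fun j hj => congrArg e (hs j hj))

theorem IsValid.pi {D : Digraph V} {enc : (V → X) → C} (h : IsValid D enc) (K : Type*) :
    IsValid D fun (x : V → K → X) (k : K) => enc fun v => x v k := by
  intro x y i hxy hs
  funext k
  exact h _ _ i (congrFun hxy k) fun j hj => congrFun (hs j hj) k

theorem isValid_id (D : Digraph V) : IsValid D (id : (V → X) → V → X) :=
  fun _ _ i h _ => congrFun h i

theorem card_word (n : ℕ) : Fintype.card (Word n) = 2 ^ n := by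
  simp [Word, ZMod.card]

/-- Words of length `k * t` are `k`-tuples of words of length `t`. -/
noncomputable def wordMulEquiv (k t : ℕ) : Word (k * t) ≃ (Fin k → Word t) :=
  Fintype.equivOfCardEq (by simp [ZMod.card, ← pow_mul, mul_comm])

theorem optLength_le_of_isValid {D : Digraph V} {t q : ℕ} [Fintype C]
    {enc : (V → Word t) → C} (h : IsValid D enc) (hq : Fintype.card C ≤ 2 ^ q) :
    optLength D t ≤ q := by
  obtain ⟨f⟩ := Function.Embedding.nonempty_of_card_le (hq.trans_eq (card_word q).symm)
  exact Nat.sInf_le (nonempty_code_iff.2 ⟨_, h.comp_injective f.injective⟩)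

/-- The factor 2 pays for rounding the logarithm of the alphabet size up to a whole number of bits.
-/
theorem two_pow_optLength_le {D : Digraph V} {t : ℕ} [Fintype C] [Nonempty C]
    {enc : (V → Word t) → C} (h : IsValid D enc) :
    2 ^ optLength D t ≤ 2 * Fintype.card C := by
  have h1 : optLength D t ≤ Nat.clog 2 (Fintype.card C) :=
    optLength_le_of_isValid h (Nat.le_pow_clog (by norm_num) _)
  rcases Nat.eq_zero_or_pos (optLength D t) with h0 | h0
  · have := Fintype.card_pos (α := C)
    rw [h0, pow_zero]
    omega
  · obtain ⟨q, hq⟩ := Nat.exists_eq_succ_of_ne_zero h0.ne'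
    have : ¬ Fintype.card C ≤ 2 ^ q := fun hc => by
      have := optLength_le_of_isValid h hc
      omega
    rw [hq, pow_succ]
    omega

theorem exists_isValid_of_optLength_le [Finite V] (D : Digraph V) {t p : ℕ}
    (hp : optLength D t ≤ p) : ∃ enc : (V → Word t) → Word p, IsValid D enc := by
  classical
  have := Fintype.ofFinite V
  have hne : {p : ℕ | Nonempty (Code D t p)}.Nonempty := by
    refine ⟨Fintype.card V * t, nonempty_code_iff.2 ?_⟩
    have e : (V → Word t) ≃ Word (Fintype.card V * t) :=
      Fintype.equivOfCardEq (by simp [ZMod.card, ← pow_mul, mul_comm])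
    exact ⟨_, (isValid_id D).comp_injective e.injective⟩
  obtain ⟨enc, henc⟩ := nonempty_code_iff.1 (Nat.sInf_mem hne)
  obtain ⟨f⟩ : Nonempty (Word (optLength D t) ↪ Word p) :=
    Function.Embedding.nonempty_of_card_le (by
      rw [card_word, card_word]
      exact Nat.pow_le_pow_right (by norm_num) hp)
  exact ⟨_, henc.comp_injective f.injective⟩

theorem optLength_mul_le [Finite V] (D : Digraph V) (k t : ℕ) :
    optLength D (k * t) ≤ k * optLength D t := by
  obtain ⟨enc, h⟩ := exists_isValid_of_optLength_le D (le_refl (optLength D t))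
  refine optLength_le_of_isValid ((h.pi (Fin k)).comap_alphabet (wordMulEquiv k t).injective) ?_
  simp [ZMod.card, ← pow_mul, mul_comm]

theorem betaT_mul_le [Finite V] (D : Digraph V) (k t : ℕ+) :
    betaT D ((k * t : ℕ+) : ℕ) ≤ betaT D t := by
  have hk : (0 : ℝ) < (k : ℕ) := by exact_mod_cast k.pos
  have ht : (0 : ℝ) < (t : ℕ) := by exact_mod_cast t.pos
  have h : (optLength D (k * t) : ℝ) ≤ (k : ℕ) * optLength D t := by
    exact_mod_cast optLength_mul_le D k t
  rw [betaT, betaT, PNat.mul_coe, Nat.cast_mul, div_le_div_iff₀ (by positivity) ht]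
  nlinarith

theorem betaT_nonneg (D : Digraph V) (t : ℕ) : 0 ≤ betaT D t := by
  unfold betaT
  positivity

theorem beta_le_betaT (D : Digraph V) (t : ℕ+) : beta D ≤ betaT D t :=
  ciInf_le (f := fun t : ℕ+ => betaT D t) ⟨0, by rintro _ ⟨t, rfl⟩; exact betaT_nonneg D t⟩ t

theorem mul_beta_le_optLength (D : Digraph V) {t : ℕ} (ht : 0 < t) :
    t * beta D ≤ optLength D t := by
  have h := beta_le_betaT D ⟨t, ht⟩
  have ht' : (0 : ℝ) < t := by exact_mod_cast ht
  rw [PNat.mk_coe, betaT, le_div_iff₀ ht'] at h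
  linarith

theorem exists_betaT_lt (D : Digraph V) {r : ℝ} (hr : beta D < r) : ∃ t : ℕ+, betaT D t < r :=
  exists_lt_of_ciInf_lt hr

end SingleSender

/-! ### Covering a finite commutative group by translates. -/

section Covering

variable {G : Type*} [AddCommGroup G] [Fintype G] [DecidableEq G]

/-- Averaging over `a`: each element lies in exactly `S.card` translates of `S`. -/
theorem exists_translate_inter (S U : Finset G) :
    ∃ a, S.card * U.card ≤ Fintype.card G * (U.filter fun g => g - a ∈ S).card := by
  have hsum : ∑ a : G, (U.filter fun g => g - a ∈ S).card = S.card * U.card := by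
    simp_rw [card_filter]
    rw [sum_comm]
    have (g : G) : ∑ a : G, (if g - a ∈ S then 1 else 0) = S.card := by
      have h := (Equiv.subLeft g).sum_comp fun a => if a ∈ S then 1 else 0
      simp only [Equiv.subLeft_apply] at h
      simp [h]
    simp [this, mul_comm]
  by_contra! hlt
  have := sum_lt_sum_of_nonempty (univ_nonempty (α := G)) fun a _ => hlt a
  rw [← mul_sum, hsum] at this
  simp at this

/-- Greedy choice: each new translate removes at least the fraction `|S| / |G|` of what is still
uncovered. -/
theorem exists_translates_remainder (S : Finset G) (k : ℕ) :
    ∃ T : Finset G, T.card ≤ k ∧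
      ((univ.filter fun g => ∀ a ∈ T, g - a ∉ S).card : ℝ) ≤
        Fintype.card G * (1 - (S.card : ℝ) / Fintype.card G) ^ k := by
  have hN : (0 : ℝ) < Fintype.card G := by exact_mod_cast Fintype.card_pos
  induction k with
  | zero => exact ⟨∅, by simp, by simp⟩
  | succ k ih =>
    obtain ⟨T, hT, hU⟩ := ih
    set U := univ.filter fun g => ∀ a ∈ T, g - a ∉ S with hUdef
    obtain ⟨a, ha⟩ := exists_translate_inter S U
    refine ⟨insert a T, (card_insert_le _ _).trans (by omega), ?_⟩
    have hsplit : (univ.filter fun g => ∀ b ∈ insert a T, g - b ∉ S)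
        = U.filter fun g => ¬ g - a ∈ S := by
      ext g
      simp [hUdef, and_comm]
    have hcard := card_filter_add_card_filter_not (s := U) fun g => g - a ∈ S
    have hcard' : ((U.filter fun g => g - a ∈ S).card : ℝ)
        + (U.filter fun g => ¬ g - a ∈ S).card = U.card := by exact_mod_cast hcard
    have ha' : (S.card : ℝ) * U.card ≤
        Fintype.card G * (U.filter fun g => g - a ∈ S).card := by exact_mod_cast ha
    have hS : (S.card : ℝ) / Fintype.card G ≤ 1 := by
      rw [div_le_one hN]
      exact_mod_cast card_le_univ S
    have h1 : (S.card : ℝ) / Fintype.card G * U.card ≤ (U.filter fun g => g - a ∈ S).card := by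
      rw [div_mul_eq_mul_div, div_le_iff₀ hN]
      linarith
    rw [hsplit, pow_succ, ← mul_assoc]
    calc ((U.filter fun g => ¬ g - a ∈ S).card : ℝ)
        ≤ U.card * (1 - (S.card : ℝ) / Fintype.card G) := by linarith
      _ ≤ _ := mul_le_mul_of_nonneg_right hU (by linarith)

/-- A nonempty subset of a finite commutative group covers it by few translates. -/
theorem exists_translates_cover (S : Finset G) (hS : S.Nonempty) :
    ∃ T : Finset G, (∀ g, ∃ a ∈ T, g - a ∈ S) ∧
      (T.card : ℝ) * S.card ≤ Fintype.card G * (Real.log (Fintype.card G) + 1) := by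
  have hN : (0 : ℝ) < Fintype.card G := by exact_mod_cast Fintype.card_pos
  have hs : (0 : ℝ) < S.card := by exact_mod_cast hS.card_pos
  have hsN : (S.card : ℝ) ≤ Fintype.card G := by exact_mod_cast card_le_univ S
  have hL : 0 ≤ Real.log (Fintype.card G) :=
    Real.log_nonneg (by exact_mod_cast Fintype.card_pos)
  set N : ℝ := (Fintype.card G : ℝ)
  set s : ℝ := (S.card : ℝ)
  -- Just enough steps for `N * exp (-(k * s / N)) < 1`; the remainder, being an integer, is then
  -- empty.
  set k := ⌊N / s * Real.log N⌋₊ + 1 with hk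
  have hk1 : N / s * Real.log N < k := by
    rw [hk]
    push_cast
    exact Nat.lt_floor_add_one _
  have hk2 : (k : ℝ) ≤ N / s * Real.log N + 1 := by
    rw [hk]
    push_cast
    linarith [Nat.floor_le (show 0 ≤ N / s * Real.log N by positivity)]
  obtain ⟨T, hT, hU⟩ := exists_translates_remainder S k
  refine ⟨T, ?_, ?_⟩
  · have hlt : N * (1 - s / N) ^ k < 1 := by
      have h1 : (1 - s / N) ^ k ≤ Real.exp (-(k * (s / N))) := by
        rw [← mul_neg, Real.exp_nat_mul]
        refine pow_le_pow_left₀ ?_ ?_ k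
        · rw [sub_nonneg, div_le_one hN]
          exact hsN
        · linarith [Real.add_one_le_exp (-(s / N))]
      have h2 : Real.log N < k * (s / N) := by
        calc Real.log N = N / s * Real.log N * (s / N) := by field_simp
          _ < _ := by gcongr
      calc N * (1 - s / N) ^ k ≤ N * Real.exp (-(k * (s / N))) := by gcongr
        _ < N * Real.exp (-Real.log N) := by gcongr
        _ = 1 := by rw [Real.exp_neg, Real.exp_log hN, mul_inv_cancel₀ hN.ne']
    have h0 : (univ.filter fun g => ∀ a ∈ T, g - a ∉ S).card = 0 := by
      have := hU.trans_lt hlt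
      exact Nat.lt_one_iff.1 (by exact_mod_cast this)
    intro g
    by_contra! hg
    rw [card_eq_zero] at h0
    have : g ∈ univ.filter fun g => ∀ a ∈ T, g - a ∉ S := by simpa using hg
    rw [h0] at this
    simp at this
  · have hTk : (T.card : ℝ) ≤ k := by exact_mod_cast hT
    calc (T.card : ℝ) * s ≤ (N / s * Real.log N + 1) * s := by gcongr; linarith
      _ = N * Real.log N + s := by field_simp
      _ ≤ N * (Real.log N + 1) := by linarith

end Covering

/-! ### Additivity of rates under one-sided side-information. -/

section Join

variable {A B X C : Type*}

/-- A joint encoder for two side-information digraphs, valid when the receivers of the first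
digraph know all messages of the second and those of the second know none of the first. -/
def IsJoinValid (D : Digraph A) (E : Digraph B) (h : (A → X) → (B → X) → C) : Prop :=
  (∀ y, IsValid D fun x => h x y) ∧
    ∀ x x' y y' i, h x y = h x' y' → (∀ j, E.Adj i j → y j = y' j) → y i = y' i

theorem IsJoinValid.pi {D : Digraph A} {E : Digraph B} {h : (A → X) → (B → X) → C}
    (hv : IsJoinValid D E h) (K : Type*) :
    IsJoinValid D E fun (x : A → K → X) (y : B → K → X) (k : K) =>
      h (fun a => x a k) (fun b => y b k) := by
  constructor
  · intro y x x' i hxy hs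
    funext k
    exact hv.1 _ _ _ i (congrFun hxy k) fun j hj => congrFun (hs j hj) k
  · intro x x' y y' i hxy hs
    funext k
    exact hv.2 _ _ _ _ i (congrFun hxy k) fun j hj => congrFun (hs j hj) k

theorem IsJoinValid.comap_alphabet {Y : Type*} {D : Digraph A} {E : Digraph B}
    {h : (A → X) → (B → X) → C} (hv : IsJoinValid D E h) {e : Y → X}
    (he : Function.Injective e) :
    IsJoinValid D E fun (x : A → Y) (y : B → Y) => h (fun a => e (x a)) (fun b => e (y b)) :=
  ⟨fun y => (hv.1 fun b => e (y b)).comap_alphabet he, fun _ _ _ _ i hxy hs =>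
    he (hv.2 _ _ _ _ i hxy fun j hj => congrArg e (hs j hj))⟩

/-- Each `y` reaches about `2 ^ optLength D t` codewords, so some codeword `c` is compatible with a
large set `S c` of tuples `y`, and `optLength E t` is bounded through a cover by translates of `S
c`. The 4 comes from two roundings to whole bits; the last factor bounds `log N + 1`. -/
theorem IsJoinValid.two_pow_le [Fintype A] [Fintype B] [Fintype C] {D : Digraph A}
    {E : Digraph B} {t : ℕ} {h : (A → Word t) → (B → Word t) → C} (hv : IsJoinValid D E h) :
    (2 : ℝ) ^ (optLength D t + optLength E t) ≤
      4 * Fintype.card C * (Fintype.card B * t + 1) := by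
  classical
  set N := Fintype.card (B → Word t) with hN
  have hCne : Nonempty C := ⟨h 0 0⟩
  let S : C → Finset (B → Word t) := fun c => univ.filter fun y => ∃ x, h x y = c
  have hfib (y : B → Word t) :
      2 ^ optLength D t ≤ 2 * (univ.filter fun c => ∃ x, h x y = c).card := by
    let F := {c : C // ∃ x, h x y = c}
    have hval : IsValid D fun x => (⟨h x y, x, rfl⟩ : F) :=
      fun x x' i hxx hs => hv.1 y x x' i (congrArg Subtype.val hxx) hs
    have : Nonempty F := ⟨⟨h 0 y, 0, rfl⟩⟩
    have := two_pow_optLength_le hval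
    rwa [Fintype.card_subtype] at this
  have hdouble : ∑ c, (S c).card = ∑ y, (univ.filter fun c => ∃ x, h x y = c).card := by
    simp_rw [S, card_filter]
    exact sum_comm
  obtain ⟨c, hc⟩ : ∃ c, N * 2 ^ optLength D t ≤ 2 * (Fintype.card C * (S c).card) := by
    by_contra! hlt
    have h1 := sum_lt_sum_of_nonempty (univ_nonempty (α := C)) fun c _ => hlt c
    rw [← mul_sum, ← mul_sum, hdouble] at h1
    have h2 := sum_le_sum (s := univ) fun y (_ : y ∈ univ) => hfib y
    rw [← mul_sum] at h2
    simp only [sum_const, card_univ, smul_eq_mul] at h1 h2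
    rw [← hN] at h2
    have h3 := Nat.mul_le_mul_left (Fintype.card C) h2
    linarith
  have hNpos : 0 < N := Fintype.card_pos
  have hSne : (S c).Nonempty := by
    rw [← card_pos]
    by_contra h0
    have h0' : (S c).card = 0 := by omega
    rw [h0', mul_zero, mul_zero] at hc
    have : 0 < N * 2 ^ optLength D t := by positivity
    omega
  obtain ⟨T, hT, hTc⟩ := exists_translates_cover (S c) hSne
  choose f hf hfS using hT
  -- Subtracting a common translate preserves agreement on side-information, and both shifted tuples
  -- are compatible with `c`, so the second half of `hv` applies.
  have hval : IsValid E fun y => (⟨f y, hf y⟩ : T) := by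
    intro y y' i hyy hs
    have hff : f y = f y' := congrArg Subtype.val hyy
    obtain ⟨x, hx⟩ := (mem_filter.1 (hfS y)).2
    obtain ⟨x', hx'⟩ := (mem_filter.1 (hfS y')).2
    have := hv.2 x x' _ _ i (hx.trans hx'.symm) fun j hj => by simp [hff, hs j hj]
    simpa [hff] using this
  have : Nonempty T := ⟨⟨f 0, hf 0⟩⟩
  have hE := two_pow_optLength_le hval
  rw [Fintype.card_coe] at hE
  have hE' : (2 : ℝ) ^ optLength E t ≤ 2 * T.card := by exact_mod_cast hE
  have hc' : (N : ℝ) * 2 ^ optLength D t ≤ 2 * (Fintype.card C * (S c).card) := by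
    exact_mod_cast hc
  have hNR : (0 : ℝ) < N := by exact_mod_cast hNpos
  have hlog : Real.log N ≤ Fintype.card B * t := by
    have : N = 2 ^ (Fintype.card B * t) := by
      simp [hN, ZMod.card, ← pow_mul, mul_comm]
    rw [this]
    push_cast
    rw [Real.log_pow]
    push_cast
    have h2 : Real.log 2 ≤ 1 := by linarith [Real.log_two_lt_d9]
    exact mul_le_of_le_one_right (by positivity) h2
  refine le_of_mul_le_mul_left ?_ hNR
  calc (N : ℝ) * 2 ^ (optLength D t + optLength E t)
      = (N * 2 ^ optLength D t) * 2 ^ optLength E t := by rw [pow_add, mul_assoc]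
    _ ≤ (2 * (Fintype.card C * (S c).card)) * (2 * T.card) := by gcongr
    _ = 4 * Fintype.card C * (T.card * (S c).card) := by ring
    _ ≤ 4 * Fintype.card C * (N * (Real.log N + 1)) := by gcongr
    _ ≤ 4 * Fintype.card C * (N * (Fintype.card B * t + 1)) := by gcongr
    _ = _ := by ring

/-- An exponential with base above 1 outgrows any linear function. -/
theorem nonpos_of_forall_two_rpow_le {c a : ℝ}
    (h : ∀ k : ℕ, 0 < k → (2 : ℝ) ^ (k * c) ≤ 4 * (a * k + 1)) : c ≤ 0 := by
  by_contra! hc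
  have h1 : Tendsto (fun k : ℕ => (k : ℝ) ^ 1 / ((2 : ℝ) ^ c) ^ k) atTop (nhds 0) :=
    tendsto_pow_const_div_const_pow_of_one_lt 1 (Real.one_lt_rpow (by norm_num) hc)
  have h2 : Tendsto (fun k : ℕ => (k : ℝ) ^ 0 / ((2 : ℝ) ^ c) ^ k) atTop (nhds 0) :=
    tendsto_pow_const_div_const_pow_of_one_lt 0 (Real.one_lt_rpow (by norm_num) hc)
  have h3 := (h1.const_mul (4 * a)).add (h2.const_mul 4)
  rw [mul_zero, mul_zero, add_zero] at h3
  obtain ⟨k, hk, hk0⟩ := ((h3.eventually_lt_const one_pos).and (eventually_gt_atTop 0)).exists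
  have hpos : (0 : ℝ) < ((2 : ℝ) ^ c) ^ k := by positivity
  have := h k hk0
  rw [mul_comm, Real.rpow_mul (by norm_num), Real.rpow_natCast] at this
  rw [mul_div_assoc', mul_div_assoc', ← add_div, div_lt_one hpos] at hk
  simp only [pow_one, pow_zero] at hk
  linarith

/-- Applied to `k` independent copies, the previous bound loses only a factor linear in `k`, which
cannot compensate an exponential gap. -/
theorem IsJoinValid.mul_beta_add_beta_le [Finite A] [Finite B] {D : Digraph A} {E : Digraph B}
    {t p : ℕ} (ht : 0 < t) {h : (A → Word t) → (B → Word t) → Word p}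
    (hv : IsJoinValid D E h) : t * (beta D + beta E) ≤ p := by
  have := Fintype.ofFinite A
  have := Fintype.ofFinite B
  rw [← sub_nonpos]
  refine nonpos_of_forall_two_rpow_le (a := Fintype.card B * t) fun k hk => ?_
  have hkt : 0 < k * t := Nat.mul_pos hk ht
  have h1 := ((hv.pi (Fin k)).comap_alphabet (wordMulEquiv k t).injective).two_pow_le
  have hD := mul_beta_le_optLength D hkt
  have hE := mul_beta_le_optLength E hkt
  have hcard : Fintype.card (Fin k → Word p) = 2 ^ (k * p) := by
    simp [ZMod.card, ← pow_mul, mul_comm]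
  rw [hcard] at h1
  push_cast at h1 hD hE
  calc (2 : ℝ) ^ (k * (t * (beta D + beta E) - p))
      ≤ (2 : ℝ) ^ ((optLength D (k * t) + optLength E (k * t) : ℕ) - (k * p : ℕ) : ℝ) := by
        refine Real.rpow_le_rpow_of_exponent_le (by norm_num) ?_
        push_cast
        linarith
    _ = 2 ^ (optLength D (k * t) + optLength E (k * t)) / 2 ^ (k * p) := by
        rw [Real.rpow_sub (by norm_num), Real.rpow_natCast, Real.rpow_natCast]
    _ ≤ _ := by
        rw [div_le_iff₀ (by positivity)]
        linarith

end Join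

/-! ### Two-sender codes compared with single-sender codes. -/

namespace TUICP

variable {V : Type*} {I : TUICP V}

theorem Code.eq_of_agree {t p₁ p₂ : ℕ} (c : I.Code t p₁ p₂) {x y : V → Word t} {i : V}
    (h₁ : c.enc₁ (fun j => x j) = c.enc₁ fun j => y j)
    (h₂ : c.enc₂ (fun j => x j) = c.enc₂ fun j => y j)
    (hs : ∀ j, I.D.Adj i j → x j = y j) : x i = y i := by
  rw [← c.correct x i, ← c.correct y i, h₁, h₂]
  congr 1
  funext j
  exact hs j j.2

theorem nonempty_code {t p₁ p₂ : ℕ} (enc₁ : (I.M₁ → Word t) → Word p₁)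
    (enc₂ : (I.M₂ → Word t) → Word p₂)
    (h : ∀ (x y : V → Word t) (i : V), enc₁ (fun j => x j) = enc₁ (fun j => y j) →
      enc₂ (fun j => x j) = enc₂ (fun j => y j) → (∀ j, I.D.Adj i j → x j = y j) → x i = y i) :
    Nonempty (I.Code t p₁ p₂) := by
  classical
  refine ⟨⟨enc₁, enc₂, fun i w₁ w₂ s => if hx : ∃ x : V → Word t, enc₁ (fun j => x j) = w₁ ∧
    enc₂ (fun j => x j) = w₂ ∧ ∀ j : {j : V // I.D.Adj i j}, x j = s j
    then hx.choose i else 0, fun x i => ?_⟩⟩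
  have hx : ∃ x' : V → Word t, enc₁ (fun j => x' j) = enc₁ (fun j => x j) ∧
    enc₂ (fun j => x' j) = enc₂ (fun j => x j) ∧
    ∀ j : {j : V // I.D.Adj i j}, x' j = x j := ⟨x, rfl, rfl, by simp⟩
  rw [dif_pos hx]
  exact h _ _ _ hx.choose_spec.1 hx.choose_spec.2.1 fun j hj => hx.choose_spec.2.2 ⟨j, hj⟩

theorem exists_mem_P (I : TUICP V) (v : V) : ∃ s, v ∈ I.P s := by
  have hv : v ∈ I.M₁ ∪ I.M₂ := I.cover ▸ Set.mem_univ v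
  by_cases h₁ : v ∈ I.M₁ <;> by_cases h₂ : v ∈ I.M₂
  · exact ⟨.three, h₁, h₂⟩
  · exact ⟨.one, h₁, h₂⟩
  · exact ⟨.two, h₂, h₁⟩
  · exact absurd hv (by simp [h₁, h₂])

theorem eq_of_mem_P {a b : Label} {v : V} (ha : v ∈ I.P a) (hb : v ∈ I.P b) : a = b := by
  cases a <;> cases b <;> simp_all [P]

theorem optLength_le {t : ℕ} [Finite V] (hfull : I.FullyParticipated)
    (h₂₃ : I.interactionDigraph.Adj .two .three) (h₃₂ : I.interactionDigraph.Adj .three .two) :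
    I.optLength t ≤ IndexCoding.optLength (I.sub .one) t +
      max (IndexCoding.optLength (I.sub .two) t) (IndexCoding.optLength (I.sub .three) t) := by
  obtain ⟨e₁, hv₁⟩ := exists_isValid_of_optLength_le (I.sub .one) (t := t) le_rfl
  obtain ⟨e₂, hv₂⟩ := exists_isValid_of_optLength_le (I.sub .two) (t := t)
    (le_max_left _ (IndexCoding.optLength (I.sub .three) t))
  obtain ⟨e₃, hv₃⟩ := exists_isValid_of_optLength_le (I.sub .three) (t := t)
    (le_max_right (IndexCoding.optLength (I.sub .two) t) _)
  refine Nat.sInf_le ⟨_, _, rfl, nonempty_code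
    (fun x => e₁ fun v => x ⟨v, v.2.1⟩)
    -- Both codewords have the padded length given by the maximum, so they can be added; sender 1
    -- leaves `P .three` entirely to sender 2.
    (fun x => e₂ (fun v => x ⟨v, v.2.1⟩) + e₃ fun v => x ⟨v, v.2.2⟩) ?_⟩
  intro x y i h1 h2 hs
  obtain ⟨s, hi⟩ := I.exists_mem_P i
  cases s with
  | one => exact hv₁ (fun v => x v) (fun v => y v) ⟨i, hi⟩ h1 fun j hj => hs j hj
  | two =>
    have h3 : (fun v : I.P .three => x v) = fun v : I.P .three => y v :=
      funext fun v => hs v (hfull _ _ h₂₃ i hi v v.2)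
    refine hv₂ (fun v => x v) (fun v => y v) ⟨i, hi⟩ ?_ fun j hj => hs j hj
    change e₂ (fun v => x v) + e₃ (fun v => x v) = e₂ (fun v => y v) + e₃ (fun v => y v) at h2
    rw [h3] at h2
    exact add_right_cancel h2
  | three =>
    have h3 : (fun v : I.P .two => x v) = fun v : I.P .two => y v :=
      funext fun v => hs v (hfull _ _ h₃₂ i hi v v.2)
    refine hv₃ (fun v => x v) (fun v => y v) ⟨i, hi⟩ ?_ fun j hj => hs j hj
    change e₂ (fun v => x v) + e₃ (fun v => x v) = e₂ (fun v => y v) + e₃ (fun v => y v) at h2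
    rw [h3] at h2
    exact add_left_cancel h2

theorem exists_code [Finite V] (I : TUICP V) (t : ℕ) :
    ∃ p₁ p₂ : ℕ, I.optLength t = p₁ + p₂ ∧ Nonempty (I.Code t p₁ p₂) := by
  have := Fintype.ofFinite V
  have key (M : Set V) : Nonempty ((M → Word t) ≃ Word (Nat.card M * t)) := by
    classical
    exact ⟨Fintype.equivOfCardEq (by simp [ZMod.card, ← pow_mul, mul_comm])⟩
  obtain ⟨e₁⟩ := key I.M₁
  obtain ⟨e₂⟩ := key I.M₂
  refine Nat.sInf_mem (s := {p : ℕ | ∃ p₁ p₂ : ℕ, p = p₁ + p₂ ∧ Nonempty (I.Code t p₁ p₂)})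
    ⟨_, _, _, rfl, nonempty_code e₁ e₂ fun x y i h1 h2 _ => ?_⟩
  have hi : i ∈ I.M₁ ∪ I.M₂ := I.cover ▸ Set.mem_univ i
  rcases hi with hi | hi
  · exact congrFun (e₁.injective h1) ⟨i, hi⟩
  · exact congrFun (e₂.injective h2) ⟨i, hi⟩

open Classical in
/-- The message tuple with prescribed values on two of the parts, and zero elsewhere. -/
noncomputable def glue {t : ℕ} {a b : Label} (x : I.P a → Word t) (y : I.P b → Word t) :
    V → Word t :=
  fun v => if h : v ∈ I.P a then x ⟨v, h⟩ else if h : v ∈ I.P b then y ⟨v, h⟩ else 0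

theorem glue_left {t : ℕ} {a b : Label} (x : I.P a → Word t) (y : I.P b → Word t) {v : V}
    (hv : v ∈ I.P a) : glue x y v = x ⟨v, hv⟩ := dif_pos hv

theorem glue_right {t : ℕ} {a b : Label} (hab : a ≠ b) (x : I.P a → Word t)
    (y : I.P b → Word t) {v : V} (hv : v ∈ I.P b) : glue x y v = y ⟨v, hv⟩ := by
  rw [glue, dif_neg fun h => hab (eq_of_mem_P h hv), dif_pos hv]

theorem glue_congr_left {t : ℕ} {a b : Label} (x x' : I.P a → Word t) (y : I.P b → Word t)
    {v : V} (hv : ∀ h : v ∈ I.P a, x ⟨v, h⟩ = x' ⟨v, h⟩) : glue x y v = glue x' y v := by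
  unfold glue
  split_ifs with h
  exacts [hv h, rfl, rfl]

theorem glue_congr_right {t : ℕ} {a b : Label} (x x' : I.P a → Word t) (y y' : I.P b → Word t)
    {v : V} (hva : v ∉ I.P a) (hv : ∀ h : v ∈ I.P b, y ⟨v, h⟩ = y' ⟨v, h⟩) :
    glue x y v = glue x' y' v := by
  unfold glue
  rw [dif_neg hva, dif_neg hva]
  split_ifs with h
  exacts [hv h, rfl]

/-- Messages outside the two parts are zero and the senders are merged. Receivers in `P a` may know
anything in `P b`, which `IsJoinValid` allows, so full participation is not needed. -/
theorem add_beta_le_of_not_adj [Finite V] {a b : Label} (hab : a ≠ b)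
    (h : ¬ I.interactionDigraph.Adj b a) {t : ℕ} (ht : 0 < t) :
    IndexCoding.beta (I.sub a) + IndexCoding.beta (I.sub b) ≤ I.betaT t := by
  obtain ⟨p₁, p₂, hp, ⟨c⟩⟩ := I.exists_code t
  obtain ⟨e⟩ : Nonempty (Word p₁ × Word p₂ ≃ Word (p₁ + p₂)) :=
    ⟨Fintype.equivOfCardEq (by simp [ZMod.card, pow_add])⟩
  let f : (I.P a → Word t) → (I.P b → Word t) → Word (p₁ + p₂) := fun x y =>
    e (c.enc₁ fun j => glue x y j, c.enc₂ fun j => glue x y j)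
  have hf : IsJoinValid (I.sub a) (I.sub b) f := by
    constructor
    · intro y x x' i hxx hs
      obtain ⟨h1, h2⟩ := Prod.mk.inj (e.injective hxx)
      have := c.eq_of_agree (i := i) h1 h2 fun j hj =>
        glue_congr_left x x' y fun hja => hs ⟨j, hja⟩ hj
      rwa [glue_left _ _ i.2, glue_left _ _ i.2] at this
    · intro x x' y y' i hxx hs
      obtain ⟨h1, h2⟩ := Prod.mk.inj (e.injective hxx)
      have := c.eq_of_agree (i := i) h1 h2 fun j hj => glue_congr_right x x' y y'
        (fun hja => h ⟨hab.symm, i, i.2, j, hja, hj⟩) fun hjb => hs ⟨j, hjb⟩ hj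
      rwa [glue_right hab _ _ i.2, glue_right hab _ _ i.2] at this
  have := hf.mul_beta_add_beta_le ht
  rw [betaT, hp, le_div_iff₀ (by exact_mod_cast ht)]
  linarith

theorem optLength_one_add_optLength_two_le [Finite V] (I : TUICP V) (t : ℕ) :
    IndexCoding.optLength (I.sub .one) t + IndexCoding.optLength (I.sub .two) t
      ≤ I.optLength t := by
  obtain ⟨p₁, p₂, hp, ⟨c⟩⟩ := I.exists_code t
  rw [hp]
  refine add_le_add
    (optLength_le_of_isValid (enc := fun x : I.P .one → Word t =>
      c.enc₁ fun j => glue (b := .two) x 0 j) ?_ (card_word _).le)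
    (optLength_le_of_isValid (enc := fun x : I.P .two → Word t =>
      c.enc₂ fun j => glue (b := .one) x 0 j) ?_ (card_word _).le)
  · intro x x' i hxx hs
    -- The second sub-codeword is constant here, since sender 2 has no message of `P .one`.
    have := c.eq_of_agree (i := i) hxx
      (congrArg c.enc₂ (funext fun j => glue_congr_left x x' 0 fun hj => absurd j.2 hj.2))
      fun j hj => glue_congr_left x x' 0 fun hja => hs ⟨j, hja⟩ hj
    rwa [glue_left _ _ i.2, glue_left _ _ i.2] at this
  · intro x x' i hxx hs
    have := c.eq_of_agree (i := i)
      (congrArg c.enc₁ (funext fun j => glue_congr_left x x' 0 fun hj => absurd j.2 hj.2))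
      hxx fun j hj => glue_congr_left x x' 0 fun hja => hs ⟨j, hja⟩ hj
    rwa [glue_left _ _ i.2, glue_left _ _ i.2] at this

theorem beta_le_betaT (I : TUICP V) (t : ℕ+) : I.beta ≤ I.betaT t :=
  ciInf_le (f := fun t : ℕ+ => I.betaT t)
    ⟨0, by rintro _ ⟨t, rfl⟩; simp only [betaT]; positivity⟩ t

theorem beta_le_of_betaT_le [Finite V] (hfull : I.FullyParticipated)
    (h₂₃ : I.interactionDigraph.Adj .two .three) (h₃₂ : I.interactionDigraph.Adj .three .two)
    (t₁ t₂ t₃ : ℕ+) :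
    I.beta ≤ max (IndexCoding.betaT (I.sub .two) t₂) (IndexCoding.betaT (I.sub .three) t₃)
      + IndexCoding.betaT (I.sub .one) t₁ := by
  -- A common multiple of the three message lengths, at which none of the three rates is larger.
  set t : ℕ+ := t₁ * t₂ * t₃ with ht
  have b₁ := betaT_mul_le (I.sub .one) (t₂ * t₃) t₁
  have b₂ := betaT_mul_le (I.sub .two) (t₁ * t₃) t₂
  have b₃ := betaT_mul_le (I.sub .three) (t₁ * t₂) t₃
  rw [show t₂ * t₃ * t₁ = t by rw [ht]; ac_rfl] at b₁
  rw [show t₁ * t₃ * t₂ = t by rw [ht]; ac_rfl] at b₂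
  have htpos : (0 : ℝ) < (t : ℕ) := by exact_mod_cast t.pos
  have hle : (I.optLength t : ℝ) ≤ IndexCoding.optLength (I.sub .one) t +
      max (IndexCoding.optLength (I.sub .two) t : ℝ)
        (IndexCoding.optLength (I.sub .three) t) := by
    exact_mod_cast optLength_le (t := t) hfull h₂₃ h₃₂
  have hT : I.betaT t ≤ IndexCoding.betaT (I.sub .one) t +
      max (IndexCoding.betaT (I.sub .two) t) (IndexCoding.betaT (I.sub .three) t) := by
    simp only [betaT, IndexCoding.betaT]
    rw [max_div_div_right htpos.le, ← add_div]
    gcongr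
  calc I.beta ≤ I.betaT t := I.beta_le_betaT t
    _ ≤ _ := hT
    _ ≤ _ := add_le_add b₁ (max_le_max b₂ b₃)
    _ = _ := add_comm _ _

end TUICP

end IndexCoding

theorem theorem6 {V : Type*} [Finite V] (I : IndexCoding.TUICP V)
    (hH : I.interactionDigraph ∈ IndexCoding.caseIID) (hfull : I.FullyParticipated) :
    I.beta = max (IndexCoding.beta (I.sub .two)) (IndexCoding.beta (I.sub .three))
      + IndexCoding.beta (I.sub .one) := by
  obtain ⟨-, h₂₃, h₃₂, h₁₃⟩ := hH
  apply le_antisymm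
  · refine le_of_forall_pos_le_add fun ε hε => ?_
    obtain ⟨t₁, h₁⟩ := IndexCoding.exists_betaT_lt (I.sub .one)
      (lt_add_of_pos_right _ (half_pos hε))
    obtain ⟨t₂, h₂⟩ := IndexCoding.exists_betaT_lt (I.sub .two)
      (lt_add_of_pos_right _ (half_pos hε))
    obtain ⟨t₃, h₃⟩ := IndexCoding.exists_betaT_lt (I.sub .three)
      (lt_add_of_pos_right _ (half_pos hε))
    have hmax := max_le_max h₂.le h₃.le
    rw [max_add_add_right] at hmax
    linarith [IndexCoding.TUICP.beta_le_of_betaT_le hfull h₂₃ h₃₂ t₁ t₂ t₃]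
  · refine le_ciInf fun t => ?_
    rw [← le_sub_iff_add_le, max_le_iff, le_sub_iff_add_le, le_sub_iff_add_le]
    constructor
    · have ht : (0 : ℝ) < (t : ℕ) := by exact_mod_cast t.pos
      have h : (IndexCoding.optLength (I.sub .one) t : ℝ) +
          IndexCoding.optLength (I.sub .two) t ≤ I.optLength t := by
        exact_mod_cast I.optLength_one_add_optLength_two_le t
      have h₁ := IndexCoding.mul_beta_le_optLength (I.sub .one) t.pos
      have h₂ := IndexCoding.mul_beta_le_optLength (I.sub .two) t.pos
      rw [IndexCoding.TUICP.betaT, le_div_iff₀ ht]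
      linarith
    -- Whichever edge between 1 and 3 is missing decides which part plays the uninformed role.
    · by_cases h : I.interactionDigraph.Adj .three .one
      · exact IndexCoding.TUICP.add_beta_le_of_not_adj (by simp) (fun h' => h₁₃ ⟨h', h⟩) t.pos
      · rw [add_comm]
        exact IndexCoding.TUICP.add_beta_le_of_not_adj (by simp) h t.pos
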